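/- **Setting.** Let $a\in\mathbb R$ and let $\rho_G:(0,\infty)\to\mathbb R$ be any continuous function such that $x^2\rho_G(x)$ is integrable on $(0,R)$ for every $R>0$. Put $$M(R)=4\pi\int_0^R x^2\rho_G(x)\,dx,\quad \Delta_K=R^2-2RM(R)+a^2,\quad \Sigma=R^2+a^2\cos^2\vartheta,\quad \rho=\frac{R^4}{\Sigma^2}\rho_G(R),$$ and consider the Kerr-like metric $$ds^2=\Big(1-\frac{2RM}{\Sigma}\Big)dt^2+\frac{4aRM}{\Sigma}\sin^2\vartheta\,dt\,d\varphi-\frac{\Sigma}{\Delta_K}dR^2-\Sigma\,d\vartheta^2-\frac{\sin^2\vartheta}{\Sigma}\big[(R^2+a^2)^2-a^2\sin^2\vartheta\,\Delta_K\big]d\varphi^2\qquad(1)$$ on the set $\mathcal D$ of all $(R,\vartheta)$ with $R>0$, $0<\vartheta<\pi$, $\Delta_K>0$ and $(R^2+a^2)^2-a^2\sin^2\vartheta\,\Delta_K>0$. Assume that there is a horizon: $\Delta_K(R_h)=0$ for some $R_h>0$. **Field equations.** For functions $\Delta(R)>0$ and $F>0$, $\chi>0$, $\omega$, $\mu$ of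 $(R,\vartheta)$, consider the metric $$ds^2=e^{\beta}\Big(\chi-\frac{\omega^2}{\chi}\Big)dt^2+\frac{2\omega e^{\beta}}{\chi}dt\,d\varphi-\frac{e^{2\mu}}{\Delta}dR^2-e^{2\mu}d\vartheta^2-\frac{e^\beta}{\chi}d\varphi^2,\qquad e^\beta=\sqrt\Delta\,F,\qquad(2)$$ and a fluid with energy-momentum tensor $T^\mu{}_\nu=(\rho+p_\vartheta)(u^\mu u_\nu-\ell^\mu\ell_\nu)-p_\vartheta\delta^\mu_\nu$, where $\ell=e^{-\mu}\sqrt\Delta\,\partial_R$ and $u=u^t(\partial_t+\Omega\,\partial_\varphi)$ is a unit time-like vector (that is, $(\omega-\Omega)^2<\chi^2$), with $\Omega$ and $p_\vartheta$ functions of $(R,\vartheta)$; thus the radial pressure is $p_R=-\rho$. With $$f=\frac{\chi^2+(\omega-\Omega)^2}{\chi^2-(\omega-\Omega)^2},\qquad g=\frac{\omega-\Omega}{\chi^2-(\omega-\Omega)^2},$$ the Einstein field equations $G_{\mu\nu}=-8\pi T_{\mu\nu}$ (signature $(+,-,-,-)$, $R_{\mu\nu}=R^{\lambda}{}_{\mu\lambda\nu}$,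 with curvature convention $R^\rho{}_{\lambda\mu\nu}=\partial_\mu\Gamma^\rho_{\lambda\nu}-\partial_\nu\Gamma^\rho_{\lambda\mu}+\cdots$) are taken in the form $$\big(\sqrt\Delta(\sqrt\Delta F)_{,R}\big)_{,R}+F_{,\vartheta\vartheta}=-8\pi Fe^{2\mu}(p_R+p_\vartheta),$$ $$(\Delta F(\ln\chi)_{,R})_{,R}+(F(\ln\chi)_{,\vartheta})_{,\vartheta}-\frac{F}{\chi^2}\big[\Delta\,\omega_{,R}^2+\omega_{,\vartheta}^2\big]=-8\pi fFe^{2\mu}(\rho+p_\vartheta),$$ $$\Big(\frac{\Delta F}{\chi^2}\omega_{,R}\Big)_{,R}+\Big(\frac{F}{\chi^2}\omega_{,\vartheta}\Big)_{,\vartheta}=-16\pi gFe^{2\mu}(\rho+p_\vartheta),$$ $$(\ln F)_{,R\vartheta}-\big[\beta_{,R}\,\mu_{,\vartheta}+(\ln F)_{,\vartheta}\,\mu_{,R}\big]+\tfrac12\beta_{,R}(\ln F)_{,\vartheta}+\frac{\chi_{,R}\chi_{,\vartheta}-\omega_{,R}\omega_{,\vartheta}}{2\chi^2}=0,$$ $$\big(\sqrt\Delta(\sqrt\Delta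 F)_{,R}\big)_{,R}-F_{,\vartheta\vartheta}+2F\Big[(\ln F)_{,\vartheta}\big(\tfrac14(\ln F)_{,\vartheta}+\mu_{,\vartheta}\big)-\tfrac14(\ln\chi)_{,\vartheta}^2\Big]-2\Delta F\Big[\beta_{,R}\big(\tfrac14\beta_{,R}+\mu_{,R}\big)-\tfrac14(\ln\chi)_{,R}^2\Big]-\frac{F}{2\chi^2}\big[\Delta\,\omega_{,R}^2-\omega_{,\vartheta}^2\big]=8\pi Fe^{2\mu}(p_R-p_\vartheta).$$ A *Kerr-like solution on* $U\subseteq\mathcal D$ consists of functions $\Delta,F,\chi,\omega,\mu,\Omega,p_\vartheta$ for which, at all points of $U$, the positivity and time-likeness conditions above hold, the metric (2) is the metric (1), and the five equations hold with the above $\rho$ and with $p_R=-\rho$. **Corollary.** Whatever the density $\rho_G$ is (it need not be Gaussian): 1. if $U\subseteq\mathcal D$ is open and $\rho$ does not vanish identically on $U$, there is no Kerr-like solution on $U$; 2. if $a\neq0$, or if $\rho_G$ is continuous at $0$ (that is, extends continuously to $[0,\infty)$), there is no Kerr-like solution on $\mathcal D$. -/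

import Mathlib

open Set MeasureTheory

noncomputable section

/-- The partial derivative of `h` with respect to the first variable `R`. -/
def dR (h : ℝ → ℝ → ℝ) : ℝ → ℝ → ℝ := fun R ϑ => deriv (fun r => h r ϑ) R

/-- The partial derivative of `h` with respect to the second variable `ϑ`. -/
def dϑ (h : ℝ → ℝ → ℝ) : ℝ → ℝ → ℝ := fun R ϑ => deriv (fun t => h R t) ϑ

/-- The functions that determine a stationary axisymmetric metric with a horizon,
`ds² = e^β (χ - ω²/χ) dt² + 2 (ω e^β/χ) dt dφ - (e^{2μ}/Δ) dR² - e^{2μ} dϑ² - (e^β/χ) dφ²`,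
where `e^β = √Δ F`. -/
structure HorizonData where
  Δ : ℝ → ℝ
  F : ℝ → ℝ → ℝ
  χ : ℝ → ℝ → ℝ
  ω : ℝ → ℝ → ℝ
  μ : ℝ → ℝ → ℝ

namespace HorizonData

/-- `e^β = √Δ F`. -/
def expβ (D : HorizonData) (R ϑ : ℝ) : ℝ := √(D.Δ R) * D.F R ϑ

/-- The matrix `g_{μν}` of the metric in the coordinates `(t, R, ϑ, φ)`. -/
def metric (D : HorizonData) (R ϑ : ℝ) : Matrix (Fin 4) (Fin 4) ℝ :=
  !![D.expβ R ϑ * (D.χ R ϑ - D.ω R ϑ ^ 2 / D.χ R ϑ), 0, 0, D.ω R ϑ * D.expβ R ϑ / D.χ R ϑ;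
     0, -(Real.exp (2 * D.μ R ϑ) / D.Δ R), 0, 0;
     0, 0, -Real.exp (2 * D.μ R ϑ), 0;
     D.ω R ϑ * D.expβ R ϑ / D.χ R ϑ, 0, 0, -(D.expβ R ϑ / D.χ R ϑ)]

/-- The logarithm of `F`. -/
def lnF (D : HorizonData) : ℝ → ℝ → ℝ := fun R ϑ => Real.log (D.F R ϑ)

/-- `β = ln (√Δ F)`. -/
def β (D : HorizonData) : ℝ → ℝ → ℝ := fun R ϑ => Real.log (D.expβ R ϑ)

/-- The logarithm of `χ`. -/
def lnχ (D : HorizonData) : ℝ → ℝ → ℝ := fun R ϑ => Real.log (D.χ R ϑ)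

/-- `f = (χ² + (ω - Ω)²) / (χ² - (ω - Ω)²)`. -/
def f (D : HorizonData) (Ω : ℝ → ℝ → ℝ) (R ϑ : ℝ) : ℝ :=
  (D.χ R ϑ ^ 2 + (D.ω R ϑ - Ω R ϑ) ^ 2) / (D.χ R ϑ ^ 2 - (D.ω R ϑ - Ω R ϑ) ^ 2)

/-- `g = (ω - Ω) / (χ² - (ω - Ω)²)`. -/
def g (D : HorizonData) (Ω : ℝ → ℝ → ℝ) (R ϑ : ℝ) : ℝ :=
  (D.ω R ϑ - Ω R ϑ) / (D.χ R ϑ ^ 2 - (D.ω R ϑ - Ω R ϑ) ^ 2)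

/-- The expression `(√Δ (√Δ F)_{,R})_{,R}`. -/
def radial (D : HorizonData) : ℝ → ℝ → ℝ :=
  dR (fun R ϑ => √(D.Δ R) * dR D.expβ R ϑ)

/-- The Einstein field equations at the point `(R, ϑ)` for an anisotropic fluid with angular
velocity `Ω`, density `ρ`, radial pressure `pR` and tangential pressure `pϑ`. -/
structure FieldEquationsAt (D : HorizonData) (Ω ρ pR pϑ : ℝ → ℝ → ℝ) (R ϑ : ℝ) : Prop where
  eq1 : D.radial R ϑ + dϑ (dϑ D.F) R ϑ
    = -8 * Real.pi * D.F R ϑ * Real.exp (2 * D.μ R ϑ) * (pR R ϑ + pϑ R ϑ)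
  eq2 : dR (fun r t => D.Δ r * D.F r t * dR D.lnχ r t) R ϑ
      + dϑ (fun r t => D.F r t * dϑ D.lnχ r t) R ϑ
      - D.F R ϑ / D.χ R ϑ ^ 2 * (D.Δ R * dR D.ω R ϑ ^ 2 + dϑ D.ω R ϑ ^ 2)
    = -8 * Real.pi * D.f Ω R ϑ * D.F R ϑ * Real.exp (2 * D.μ R ϑ) * (ρ R ϑ + pϑ R ϑ)
  eq3 : dR (fun r t => D.Δ r * D.F r t / D.χ r t ^ 2 * dR D.ω r t) R ϑ
      + dϑ (fun r t => D.F r t / D.χ r t ^ 2 * dϑ D.ω r t) R ϑ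
    = -16 * Real.pi * D.g Ω R ϑ * D.F R ϑ * Real.exp (2 * D.μ R ϑ) * (ρ R ϑ + pϑ R ϑ)
  eq4 : dϑ (dR D.lnF) R ϑ - (dR D.β R ϑ * dϑ D.μ R ϑ + dϑ D.lnF R ϑ * dR D.μ R ϑ)
      + 1 / 2 * dR D.β R ϑ * dϑ D.lnF R ϑ
      + (dR D.χ R ϑ * dϑ D.χ R ϑ - dR D.ω R ϑ * dϑ D.ω R ϑ) / (2 * D.χ R ϑ ^ 2)
    = 0
  eq5 : D.radial R ϑ - dϑ (dϑ D.F) R ϑ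
      + 2 * D.F R ϑ * (dϑ D.lnF R ϑ * (1 / 4 * dϑ D.lnF R ϑ + dϑ D.μ R ϑ)
          - 1 / 4 * dϑ D.lnχ R ϑ ^ 2)
      - 2 * D.Δ R * D.F R ϑ * (dR D.β R ϑ * (1 / 4 * dR D.β R ϑ + dR D.μ R ϑ)
          - 1 / 4 * dR D.lnχ R ϑ ^ 2)
      - D.F R ϑ / (2 * D.χ R ϑ ^ 2) * (D.Δ R * dR D.ω R ϑ ^ 2 - dϑ D.ω R ϑ ^ 2)
    = 8 * Real.pi * D.F R ϑ * Real.exp (2 * D.μ R ϑ) * (pR R ϑ - pϑ R ϑ)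

end HorizonData

/-- `M(R) = 4π ∫₀ᴿ x² ρ_G(x) dx`. -/
def massFunction (ρG : ℝ → ℝ) (R : ℝ) : ℝ := 4 * Real.pi * ∫ x in (0 : ℝ)..R, x ^ 2 * ρG x

/-- `Σ = R² + a² cos² ϑ`. -/
def kerrSigma (a R ϑ : ℝ) : ℝ := R ^ 2 + a ^ 2 * Real.cos ϑ ^ 2

/-- `Δ = R² - 2 R M(R) + a²`. -/
def kerrDelta (a : ℝ) (ρG : ℝ → ℝ) (R : ℝ) : ℝ := R ^ 2 - 2 * R * massFunction ρG R + a ^ 2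

/-- The density `ρ(R, ϑ) = (R⁴ / Σ²) ρ_G(R)`. -/
def kerrDensity (a : ℝ) (ρG : ℝ → ℝ) (R ϑ : ℝ) : ℝ := R ^ 4 / kerrSigma a R ϑ ^ 2 * ρG R

/-- `(R² + a²)² - a² Δ sin² ϑ`, the numerator in `g_{φφ}`. -/
def kerrA (a : ℝ) (ρG : ℝ → ℝ) (R ϑ : ℝ) : ℝ :=
  (R ^ 2 + a ^ 2) ^ 2 - a ^ 2 * Real.sin ϑ ^ 2 * kerrDelta a ρG R

/-- The matrix, in the coordinates `(t, R, ϑ, φ)`, of the Kerr metric with the constant mass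
replaced by the mass function `M(R)`. The off-diagonal entry is half the coefficient of `dt dφ`. -/
def kerrLikeMetric (a : ℝ) (ρG : ℝ → ℝ) (R ϑ : ℝ) : Matrix (Fin 4) (Fin 4) ℝ :=
  !![1 - 2 * R * massFunction ρG R / kerrSigma a R ϑ, 0, 0,
      2 * a * R * massFunction ρG R / kerrSigma a R ϑ * Real.sin ϑ ^ 2;
     0, -(kerrSigma a R ϑ / kerrDelta a ρG R), 0, 0;
     0, 0, -kerrSigma a R ϑ, 0;
     2 * a * R * massFunction ρG R / kerrSigma a R ϑ * Real.sin ϑ ^ 2, 0, 0,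
      -(Real.sin ϑ ^ 2 / kerrSigma a R ϑ * kerrA a ρG R ϑ)]

/-- The points `(R, ϑ)` off the axis at which `Δ > 0` and `g_{φφ} < 0`, so that the Kerr-like
metric can be compared with a metric of the form `HorizonData.metric`. -/
def kerrDomain (a : ℝ) (ρG : ℝ → ℝ) : Set (ℝ × ℝ) :=
  {q | 0 < q.1 ∧ 0 < q.2 ∧ q.2 < Real.pi ∧ 0 < kerrDelta a ρG q.1 ∧ 0 < kerrA a ρG q.1 q.2}

/-- The metric given by `D`, together with a fluid of angular velocity `Ω`, density
`kerrDensity a ρG`, radial pressure `pR = -ρ` and tangential pressure `pϑ`, is on `U` a solution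
of the field equations which has the Kerr-like form. The last-but-one condition says that
the four-velocity `u ∝ ∂_t + Ω ∂_φ` is time-like. -/
structure IsKerrLikeSolutionOn (a : ℝ) (ρG : ℝ → ℝ) (U : Set (ℝ × ℝ))
    (D : HorizonData) (Ω pϑ : ℝ → ℝ → ℝ) : Prop where
  Δ_pos : ∀ q ∈ U, 0 < D.Δ q.1
  F_pos : ∀ q ∈ U, 0 < D.F q.1 q.2
  χ_pos : ∀ q ∈ U, 0 < D.χ q.1 q.2
  metric_eq : ∀ q ∈ U, D.metric q.1 q.2 = kerrLikeMetric a ρG q.1 q.2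
  timelike : ∀ q ∈ U, (D.ω q.1 q.2 - Ω q.1 q.2) ^ 2 < D.χ q.1 q.2 ^ 2
  field_eq : ∀ q ∈ U, D.FieldEquationsAt Ω (kerrDensity a ρG)
    (fun R ϑ => -kerrDensity a ρG R ϑ) pϑ q.1 q.2

end

noncomputable section

/-! Part 1 comes from a clash of signs. Comparing (2) with (1) pointwise forces `F = sin ϑ` and
fixes `Δ`, `χ`, `ω`, `exp (2μ)` (`HorizonData.eq_of_metric_eq`). Subtracting the first field
equation from the fifth removes both `p_ϑ` and the radial second derivative, so `ρG` need not be
differentiable. By `kerr_first_order_identity` the left side of the difference is `2 sin ϑ ·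
8πR⁴ρG/Σ`, whereas `p_R = -ρ` makes the right side the negative of this. Hence `ρG R = 0` at every
point of an open `U` (`IsKerrLikeSolutionOn.density_eq_zero`).

For part 2 it remains to find matter where `Δ > 0`. Near the centre `Δ > 0`; were `ρG` zero wherever
`Δ > 0`, the mass inside the innermost horizon `R₁` would vanish, giving `Δ(R₁) = R₁² + a² > 0`,
which is absurd (`exists_density_ne_zero`). -/

/-- The first-order part of the fifth minus the first field equation, evaluated on the Kerr-like
metric with `k = sin² ϑ`, `D = Δ'`. -/
lemma kerr_first_order_identity {R a Δ D k S A : ℝ} (hk : k ≠ 0) (hΔ : Δ ≠ 0)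
    (hS : S = R ^ 2 + a ^ 2 * (1 - k)) (hA : A = (R ^ 2 + a ^ 2) ^ 2 - a ^ 2 * k * Δ)
    (hS0 : S ≠ 0) (hA0 : A ≠ 0) :
    1 + (1 - k) / k / 4 - a ^ 2 * (1 - k) / S
      - 1 / 4 * ((1 - k) / k * (2 * a ^ 2 * k / S + 1 - 2 * a ^ 2 * k * Δ / A) ^ 2)
      - Δ * (D / (2 * Δ) * (1 / 4 * (D / (2 * Δ)) + R / S)
        - 1 / 4 * (D / (2 * Δ) + 2 * R / S - (4 * R * (R ^ 2 + a ^ 2) - a ^ 2 * k * D) / A) ^ 2)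
      - k * A ^ 2 / (4 * Δ * S ^ 2) *
        (Δ * (a * ((2 * R - D) * A - (R ^ 2 + a ^ 2 - Δ) *
          (4 * R * (R ^ 2 + a ^ 2) - a ^ 2 * k * D)) / A ^ 2) ^ 2
          - (a * (R ^ 2 + a ^ 2 - Δ)) ^ 2 * (4 * a ^ 4 * k * (1 - k) * Δ ^ 2) / A ^ 4)
    = (R * (2 * R - D) - (R ^ 2 + a ^ 2 - Δ)) / S := by
  field_simp
  subst hS hA
  ring

open Filter Topology

variable {a : ℝ} {ρG : ℝ → ℝ}

/-! ### Derivatives of the mass function and of `Δ` -/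

/-- The derivative of `kerrDelta`. -/
def kerrDeltaDeriv (ρG : ℝ → ℝ) (R : ℝ) : ℝ :=
  2 * R - 2 * massFunction ρG R - 2 * R * (4 * Real.pi * (R ^ 2 * ρG R))

lemma hasDerivAt_massFunction (hcont : ContinuousOn ρG (Ioi 0))
    (hint : ∀ R : ℝ, 0 < R → IntervalIntegrable (fun x => x ^ 2 * ρG x) volume 0 R)
    {R : ℝ} (hR : 0 < R) :
    HasDerivAt (massFunction ρG) (4 * Real.pi * (R ^ 2 * ρG R)) R := by
  have hc : ContinuousOn (fun x => x ^ 2 * ρG x) (Ioi 0) := by fun_prop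
  exact (intervalIntegral.integral_hasDerivAt_right (hint R hR)
    (hc.stronglyMeasurableAtFilter isOpen_Ioi R hR)
    (hc.continuousAt (Ioi_mem_nhds hR))).const_mul _

lemma hasDerivAt_kerrDelta (hcont : ContinuousOn ρG (Ioi 0))
    (hint : ∀ R : ℝ, 0 < R → IntervalIntegrable (fun x => x ^ 2 * ρG x) volume 0 R)
    {R : ℝ} (hR : 0 < R) :
    HasDerivAt (kerrDelta a ρG) (kerrDeltaDeriv ρG R) R := by
  have h := (((hasDerivAt_id R).pow 2).sub (((hasDerivAt_id R).const_mul 2).mul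
    (hasDerivAt_massFunction hcont hint hR))).add_const (a ^ 2)
  refine h.congr_deriv ?_
  simp [kerrDeltaDeriv]
  ring

lemma kerrSigma_pos {R ϑ : ℝ} (hR : 0 < R) : 0 < kerrSigma a R ϑ := by
  unfold kerrSigma; positivity

lemma two_mul_massFunction (R : ℝ) :
    2 * R * massFunction ρG R = R ^ 2 + a ^ 2 - kerrDelta a ρG R := by
  unfold kerrDelta; ring

/-! ### Reading off the metric functions -/

/-- Equality with the Kerr-like metric determines the functions of a `HorizonData`. -/
lemma HorizonData.eq_of_metric_eq {D : HorizonData} {R ϑ : ℝ}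
    (hq : (R, ϑ) ∈ kerrDomain a ρG) (hΔ : 0 < D.Δ R) (hF : 0 < D.F R ϑ) (hχ : 0 < D.χ R ϑ)
    (h : D.metric R ϑ = kerrLikeMetric a ρG R ϑ) :
    D.Δ R = kerrDelta a ρG R ∧ Real.exp (2 * D.μ R ϑ) = kerrSigma a R ϑ ∧
    D.F R ϑ = Real.sin ϑ ∧
    D.χ R ϑ = √(kerrDelta a ρG R) * kerrSigma a R ϑ / (Real.sin ϑ * kerrA a ρG R ϑ) ∧
    D.ω R ϑ = a * (R ^ 2 + a ^ 2 - kerrDelta a ρG R) / kerrA a ρG R ϑ := by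
  obtain ⟨hR, h0, hpi, hK, hA⟩ := hq
  dsimp only at hR h0 hpi hK hA
  have hS : 0 < kerrSigma a R ϑ := kerrSigma_pos hR
  have hs : 0 < Real.sin ϑ := Real.sin_pos_of_pos_of_lt_pi h0 hpi
  have htt := congrFun (congrFun h 0) 0
  have htφ := congrFun (congrFun h 0) 3
  have hRR := congrFun (congrFun h 1) 1
  have hϑϑ := congrFun (congrFun h 2) 2
  have hφφ := congrFun (congrFun h 3) 3
  simp [HorizonData.metric, kerrLikeMetric] at htt htφ hRR hϑϑ hφφ
  have hΔeq : D.Δ R = kerrDelta a ρG R := by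
    rw [hϑϑ] at hRR
    field_simp at hRR
    exact hRR.symm
  have hsq : 0 < √(kerrDelta a ρG R) := Real.sqrt_pos.2 hK
  have hβ0 : 0 < D.expβ R ϑ := by
    unfold HorizonData.expβ; rw [hΔeq]; positivity
  -- The Kerr determinant identity for the `(t, φ)` block. It is algebraic in the value of `M` at
  -- `R`, so a variable mass does no harm.
  have hkA : (kerrSigma a R ϑ - 2 * R * massFunction ρG R) * kerrA a ρG R ϑ
      + (2 * a * R * massFunction ρG R) ^ 2 * Real.sin ϑ ^ 2
      = kerrDelta a ρG R * kerrSigma a R ϑ ^ 2 := by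
    unfold kerrA kerrSigma kerrDelta
    rw [Real.cos_sq']
    ring
  -- Minus the determinant of the `(t, φ)` block of (2) is `e^{2β}`, free of `χ` and `ω`.
  have hdet : D.expβ R ϑ ^ 2 = kerrDelta a ρG R * Real.sin ϑ ^ 2 := by
    have h1 : D.expβ R ϑ ^ 2 = (D.expβ R ϑ * (D.χ R ϑ - D.ω R ϑ ^ 2 / D.χ R ϑ))
        * (D.expβ R ϑ / D.χ R ϑ) + (D.ω R ϑ * D.expβ R ϑ / D.χ R ϑ) ^ 2 := by
      field_simp
      ring
    rw [h1, htt, htφ, hφφ]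
    field_simp
    linear_combination hkA
  have hβ : D.expβ R ϑ = √(kerrDelta a ρG R) * Real.sin ϑ := by
    rw [← pow_left_inj₀ hβ0.le (by positivity) two_ne_zero, hdet, mul_pow, Real.sq_sqrt hK.le]
  have hFeq : D.F R ϑ = Real.sin ϑ := by
    have h1 := hβ
    unfold HorizonData.expβ at h1
    rw [hΔeq] at h1
    exact mul_left_cancel₀ hsq.ne' h1
  refine ⟨hΔeq, hϑϑ, hFeq, ?_, ?_⟩
  · rw [hβ] at hφφ
    field_simp at hφφ ⊢
    linear_combination -hφφ
  · rw [← two_mul_massFunction]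
    rw [mul_div_assoc, hφφ] at htφ
    field_simp at htφ ⊢
    linear_combination htφ

/-! ### Vanishing of the density -/

/-- On the Kerr-like metric the difference of the fifth and the first field equation contains only
first derivatives, and it forces the density to vanish. -/
lemma IsKerrLikeSolutionOn.density_eq_zero (hcont : ContinuousOn ρG (Ioi 0))
    (hint : ∀ R : ℝ, 0 < R → IntervalIntegrable (fun x => x ^ 2 * ρG x) volume 0 R)
    {U : Set (ℝ × ℝ)} (hU : IsOpen U) (hUK : U ⊆ kerrDomain a ρG) {D : HorizonData}
    {Ω pϑ : ℝ → ℝ → ℝ} (hD : IsKerrLikeSolutionOn a ρG U D Ω pϑ) {R ϑ : ℝ} (hq : (R, ϑ) ∈ U) :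
    ρG R = 0 := by
  have key : ∀ r t, (r, t) ∈ U → _ := fun r t hrt => HorizonData.eq_of_metric_eq (hUK hrt)
    (hD.Δ_pos _ hrt) (hD.F_pos _ hrt) (hD.χ_pos _ hrt) (hD.metric_eq _ hrt)
  have hpos : ∀ r t, (r, t) ∈ U → 0 < r ∧ 0 < Real.sin t ∧ 0 < kerrDelta a ρG r ∧
      0 < kerrA a ρG r t ∧ 0 < kerrSigma a r t := fun r t hrt =>
    have ⟨h1, h2, h3, h4, h5⟩ := hUK hrt
    ⟨h1, Real.sin_pos_of_pos_of_lt_pi h2 h3, h4, h5, kerrSigma_pos h1⟩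
  -- Openness of `U` turns the pointwise formulas into equalities of germs along each coordinate
  -- line, which is what `deriv` needs.
  have hUR : ∀ᶠ r in 𝓝 R, (r, ϑ) ∈ U :=
    (Continuous.prodMk_left ϑ).continuousAt.eventually_mem (hU.mem_nhds hq)
  have hUϑ : ∀ᶠ t in 𝓝 ϑ, (R, t) ∈ U :=
    (Continuous.prodMk_right R).continuousAt.eventually_mem (hU.mem_nhds hq)
  obtain ⟨hR, hs, hΔ, hA, hS⟩ := hpos R ϑ hq
  set d := kerrDeltaDeriv ρG R with hd
  have lnχ_eq : ∀ r t, (r, t) ∈ U → D.lnχ r t = 1 / 2 * Real.log (kerrDelta a ρG r)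
      + Real.log (kerrSigma a r t) - (Real.log (Real.sin t) + Real.log (kerrA a ρG r t)) := by
    intro r t hrt
    obtain ⟨-, -, -, h4, -⟩ := key r t hrt
    obtain ⟨-, p2, p3, p4, p5⟩ := hpos r t hrt
    rw [HorizonData.lnχ, h4, Real.log_div (by positivity) (by positivity),
      Real.log_mul (by positivity) (by positivity), Real.log_mul (by positivity) (by positivity),
      Real.log_sqrt p3.le]
    ring
  have β_eq : ∀ r t, (r, t) ∈ U → D.β r t = 1 / 2 * Real.log (kerrDelta a ρG r)
      + Real.log (Real.sin t) := by
    intro r t hrt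
    obtain ⟨h1, -, h3, -, -⟩ := key r t hrt
    obtain ⟨-, p2, p3, -, -⟩ := hpos r t hrt
    rw [HorizonData.β, HorizonData.expβ, h1, h3, Real.log_mul (by positivity) (by positivity),
      Real.log_sqrt p3.le]
    ring
  have μ_eq : ∀ r t, (r, t) ∈ U → D.μ r t = 1 / 2 * Real.log (kerrSigma a r t) := by
    intro r t hrt
    obtain ⟨-, h2, -⟩ := key r t hrt
    rw [← h2, Real.log_exp]
    ring
  -- derivatives of the building blocks
  have dΔ := hasDerivAt_kerrDelta (a := a) hcont hint hR
  rw [← hd] at dΔ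
  have dSR : HasDerivAt (fun r => kerrSigma a r ϑ) (2 * R) R := by
    exact (((hasDerivAt_id R).pow 2).add_const (a ^ 2 * Real.cos ϑ ^ 2)).congr_deriv (by simp)
  have dSϑ : HasDerivAt (fun t => kerrSigma a R t) (-(2 * a ^ 2 * Real.cos ϑ * Real.sin ϑ)) ϑ := by
    have h := (((Real.hasDerivAt_cos ϑ).pow 2).const_mul (a ^ 2)).const_add (R ^ 2)
    refine h.congr_deriv ?_
    push_cast
    ring
  have dAR : HasDerivAt (fun r => kerrA a ρG r ϑ)
      (4 * R * (R ^ 2 + a ^ 2) - a ^ 2 * Real.sin ϑ ^ 2 * d) R := by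
    have h := ((((hasDerivAt_id R).pow 2).add_const (a ^ 2)).pow 2).sub
      (dΔ.const_mul (a ^ 2 * Real.sin ϑ ^ 2))
    refine h.congr_deriv ?_
    simp
    ring
  have dAϑ : HasDerivAt (fun t => kerrA a ρG R t)
      (-(2 * a ^ 2 * Real.sin ϑ * Real.cos ϑ * kerrDelta a ρG R)) ϑ := by
    have h := ((((Real.hasDerivAt_sin ϑ).pow 2).const_mul (a ^ 2)).mul_const
      (kerrDelta a ρG R)).const_sub ((R ^ 2 + a ^ 2) ^ 2)
    refine h.congr_deriv ?_
    push_cast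
    ring
  have dsin := Real.hasDerivAt_sin ϑ
  -- derivatives of the metric functions
  have hFϑϑ : dϑ (dϑ D.F) R ϑ = -Real.sin ϑ := by
    have h1 : (fun t => D.F R t) =ᶠ[𝓝 ϑ] Real.sin := by
      filter_upwards [hUϑ] with t ht using (key R t ht).2.2.1
    have h2 := h1.deriv.deriv_eq
    simpa [dϑ] using h2
  have hlnF : dϑ D.lnF R ϑ = Real.cos ϑ / Real.sin ϑ := by
    refine (EventuallyEq.deriv_eq ?_).trans (dsin.log hs.ne').deriv
    filter_upwards [hUϑ] with t ht
    rw [HorizonData.lnF, (key R t ht).2.2.1]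
  have hμϑ : dϑ D.μ R ϑ = 1 / 2 * (-(2 * a ^ 2 * Real.cos ϑ * Real.sin ϑ) / kerrSigma a R ϑ) := by
    refine (EventuallyEq.deriv_eq ?_).trans ((dSϑ.log hS.ne').const_mul (1 / 2)).deriv
    filter_upwards [hUϑ] with t ht using μ_eq R t ht
  have hμR : dR D.μ R ϑ = 1 / 2 * (2 * R / kerrSigma a R ϑ) := by
    refine (EventuallyEq.deriv_eq ?_).trans ((dSR.log hS.ne').const_mul (1 / 2)).deriv
    filter_upwards [hUR] with r hr using μ_eq r ϑ hr
  have hβR : dR D.β R ϑ = 1 / 2 * (d / kerrDelta a ρG R) := by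
    refine (EventuallyEq.deriv_eq ?_).trans
      (((dΔ.log hΔ.ne').const_mul (1 / 2)).add_const (Real.log (Real.sin ϑ))).deriv
    filter_upwards [hUR] with r hr using β_eq r ϑ hr
  have hχR : dR D.lnχ R ϑ = 1 / 2 * (d / kerrDelta a ρG R) + 2 * R / kerrSigma a R ϑ
      - (4 * R * (R ^ 2 + a ^ 2) - a ^ 2 * Real.sin ϑ ^ 2 * d) / kerrA a ρG R ϑ := by
    refine (EventuallyEq.deriv_eq ?_).trans ((((dΔ.log hΔ.ne').const_mul (1 / 2)).add
      (dSR.log hS.ne')).sub ((dAR.log hA.ne').const_add (Real.log (Real.sin ϑ)))).deriv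
    filter_upwards [hUR] with r hr using lnχ_eq r ϑ hr
  have hχϑ : dϑ D.lnχ R ϑ = -(2 * a ^ 2 * Real.cos ϑ * Real.sin ϑ) / kerrSigma a R ϑ
      - (Real.cos ϑ / Real.sin ϑ
        + -(2 * a ^ 2 * Real.sin ϑ * Real.cos ϑ * kerrDelta a ρG R) / kerrA a ρG R ϑ) := by
    refine (EventuallyEq.deriv_eq ?_).trans (((dSϑ.log hS.ne').const_add
      (1 / 2 * Real.log (kerrDelta a ρG R))).sub
        ((dsin.log hs.ne').add (dAϑ.log hA.ne'))).deriv
    filter_upwards [hUϑ] with t ht using lnχ_eq R t ht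
  have hωR : dR D.ω R ϑ = (a * (2 * R - d) * kerrA a ρG R ϑ
      - a * (R ^ 2 + a ^ 2 - kerrDelta a ρG R)
        * (4 * R * (R ^ 2 + a ^ 2) - a ^ 2 * Real.sin ϑ ^ 2 * d)) / kerrA a ρG R ϑ ^ 2 := by
    have h := (((((hasDerivAt_id R).pow 2).add_const (a ^ 2)).sub dΔ).const_mul a).div dAR hA.ne'
    refine (EventuallyEq.deriv_eq ?_).trans (h.deriv.trans (by simp))
    filter_upwards [hUR] with r hr using (key r ϑ hr).2.2.2.2
  have hωϑ : dϑ D.ω R ϑ = a * (R ^ 2 + a ^ 2 - kerrDelta a ρG R)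
      * (2 * a ^ 2 * Real.sin ϑ * Real.cos ϑ * kerrDelta a ρG R) / kerrA a ρG R ϑ ^ 2 := by
    have h := (hasDerivAt_const ϑ (a * (R ^ 2 + a ^ 2 - kerrDelta a ρG R))).div dAϑ hA.ne'
    refine (EventuallyEq.deriv_eq ?_).trans (h.deriv.trans (by ring))
    filter_upwards [hUϑ] with t ht using (key R t ht).2.2.2.2
  obtain ⟨e1, e2, e3, e4, -⟩ := key R ϑ hq
  have eq1 := (hD.field_eq _ hq).eq1
  have eq5 := (hD.field_eq _ hq).eq5
  dsimp only at eq1 eq5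
  have hχsq : D.χ R ϑ ^ 2 = kerrDelta a ρG R * kerrSigma a R ϑ ^ 2
      / (Real.sin ϑ ^ 2 * kerrA a ρG R ϑ ^ 2) := by
    rw [e4, div_pow, mul_pow, mul_pow, Real.sq_sqrt hΔ.le]
  rw [hFϑϑ, e2, e3] at eq1
  rw [hFϑϑ, hlnF, hμϑ, hμR, hβR, hχR, hχϑ, hωR, hωϑ, hχsq, e1, e2, e3] at eq5
  have hcs := Real.cos_sq' ϑ
  have hid := kerr_first_order_identity (R := R) (a := a) (D := d)
    (S := kerrSigma a R ϑ) (A := kerrA a ρG R ϑ) (pow_pos hs 2).ne' hΔ.ne'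
    (by rw [← hcs]; rfl) rfl hS.ne' hA.ne'
  rw [← hcs] at hid
  have hdR : R * (2 * R - d) - (R ^ 2 + a ^ 2 - kerrDelta a ρG R)
      = 8 * Real.pi * R ^ 4 * ρG R := by
    rw [hd, kerrDeltaDeriv, kerrDelta]
    ring
  rw [hdR] at hid
  have hρ : kerrDensity a ρG R ϑ = R ^ 4 / kerrSigma a R ϑ ^ 2 * ρG R := rfl
  rw [hρ] at eq1 eq5
  -- The radial term is never computed, only cancelled; from here on all is rational algebra.
  generalize hX : D.radial R ϑ = X at eq1 eq5
  generalize kerrDelta a ρG R = Δ at *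
  generalize kerrA a ρG R ϑ = A at *
  generalize kerrSigma a R ϑ = S at *
  generalize Real.sin ϑ = s at *
  generalize Real.cos ϑ = c at *
  -- Left: first-order terms via `hid`. Right: `16πF e^{2μ} p_R`, halved by no `p_ϑ` contribution
  -- since it cancels.
  have hzero : 2 * s * (8 * Real.pi * R ^ 4 * ρG R / S)
      = 2 * s * -(8 * Real.pi * R ^ 4 * ρG R / S) := by
    linear_combination (norm := (field_simp; ring)) eq5 - eq1 - 2 * s * hid
  have hz : 8 * Real.pi * R ^ 4 * ρG R / S = 0 := by
    have := mul_left_cancel₀ (by positivity) hzero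
    linarith
  have hpi := Real.pi_pos
  field_simp at hz
  simpa [hR.ne'] using hz

/-! ### Geometry of the domain -/

lemma isOpen_kerrDomain (hcont : ContinuousOn ρG (Ioi 0))
    (hint : ∀ R : ℝ, 0 < R → IntervalIntegrable (fun x => x ^ 2 * ρG x) volume 0 R) :
    IsOpen (kerrDomain a ρG) := by
  rw [isOpen_iff_mem_nhds]
  rintro ⟨R, ϑ⟩ ⟨hR, h0, hpi, hΔ, hA⟩
  dsimp only at hR h0 hpi hΔ hA
  have hΔc : ContinuousAt (fun q : ℝ × ℝ => kerrDelta a ρG q.1) (R, ϑ) :=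
    ContinuousAt.comp (x := (R, ϑ)) (f := Prod.fst)
      (hasDerivAt_kerrDelta hcont hint hR).continuousAt continuousAt_fst
  have hAc : ContinuousAt (fun q : ℝ × ℝ => kerrA a ρG q.1 q.2) (R, ϑ) := by
    unfold kerrA
    fun_prop
  filter_upwards [continuousAt_fst.eventually_const_lt hR,
    continuousAt_snd.eventually_const_lt h0, continuousAt_snd.eventually_lt_const hpi,
    hΔc.eventually_const_lt hΔ, hAc.eventually_const_lt hA] with q h1 h2 h3 h4 h5
  exact ⟨h1, h2, h3, h4, h5⟩

/-- Near the axis `kerrDomain` contains every radius at which `Δ > 0`. -/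
lemma exists_mem_kerrDomain {R : ℝ} (hR : 0 < R) (hΔ : 0 < kerrDelta a ρG R) :
    ∃ ϑ, (R, ϑ) ∈ kerrDomain a ρG := by
  have hc : ContinuousAt (fun t => kerrA a ρG R t) 0 := by
    unfold kerrA
    fun_prop
  -- On the axis the term containing `Δ` drops out.
  have h0 : 0 < kerrA a ρG R 0 := by
    simp only [kerrA, Real.sin_zero]
    have : 0 < R ^ 2 + a ^ 2 := by positivity
    nlinarith
  have h := (hc.eventually_const_lt h0).filter_mono (nhdsWithin_le_nhds (s := Ioi 0))
  obtain ⟨t, ht, ht0, htpi⟩ := (h.and (Ioo_mem_nhdsGT Real.pi_pos)).exists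
  exact ⟨t, hR, ht0, htpi, hΔ, ht⟩

/-! ### Behaviour at the centre -/

lemma tendsto_massFunction_zero
    (hint : ∀ R : ℝ, 0 < R → IntervalIntegrable (fun x => x ^ 2 * ρG x) volume 0 R) :
    Tendsto (massFunction ρG) (𝓝[>] 0) (𝓝 0) := by
  have hI := (intervalIntegrable_iff_integrableOn_Icc_of_le zero_le_one).1 (hint 1 one_pos)
  rw [← uIcc_of_le zero_le_one] at hI
  have h := intervalIntegral.continuousOn_primitive_interval hI
  have h0 := (h 0 (by simp)).mono_left
    (nhdsWithin_le_of_mem (by rw [uIcc_of_le zero_le_one]; exact Icc_mem_nhdsGT one_pos) :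
      𝓝[>] (0 : ℝ) ≤ 𝓝[uIcc 0 1] 0)
  unfold massFunction
  simpa using h0.const_mul (4 * Real.pi)

/-- A density bounded near the centre gives a mass function of order `R³`. -/
lemma kerrDelta_zero_pos_of_continuousWithinAt (hρ : ContinuousWithinAt ρG (Ici 0) 0) :
    ∀ᶠ R in 𝓝[>] (0 : ℝ), 0 < kerrDelta 0 ρG R := by
  set C := |ρG 0| + 1
  have hC : 0 < C := by positivity
  have hb : ∀ᶠ x in 𝓝[≥] (0 : ℝ), |ρG x| < C :=
    hρ.abs.eventually_lt_const (by simp [C])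
  obtain ⟨ε, hε, hbε⟩ := mem_nhdsGE_iff_exists_Ico_subset.1 hb
  -- With `R < 1`, this bound on `R` gives `8πC R² < 1`, hence `2RM < R²`.
  have hpos : 0 < (8 * Real.pi * C + 1)⁻¹ := by have := Real.pi_pos; positivity
  filter_upwards [Ioo_mem_nhdsGT (lt_min (lt_min hε one_pos) hpos)] with R hR
  obtain ⟨hR0, hR1⟩ := hR
  simp only [lt_min_iff] at hR1
  obtain ⟨⟨hRε, hR1⟩, hRC⟩ := hR1
  have hI : ‖∫ x in (0 : ℝ)..R, x ^ 2 * ρG x‖ ≤ (R ^ 2 * C) * |R - 0| := by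
    refine intervalIntegral.norm_integral_le_of_norm_le_const fun x hx => ?_
    rw [uIoc_of_le hR0.le] at hx
    have h1 : |ρG x| < C := hbε ⟨hx.1.le, hx.2.trans_lt hRε⟩
    rw [Real.norm_eq_abs, abs_mul, abs_of_nonneg (sq_nonneg x)]
    exact mul_le_mul (pow_le_pow_left₀ hx.1.le hx.2 2) h1.le (abs_nonneg _) (sq_nonneg _)
  rw [Real.norm_eq_abs, sub_zero, abs_of_pos hR0] at hI
  have hI' := (le_abs_self _).trans hI
  have hpi := Real.pi_pos
  rw [lt_inv_comm₀ hR0 (by positivity), inv_eq_one_div, lt_div_iff₀ hR0] at hRC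
  have hM : massFunction ρG R ≤ 4 * Real.pi * (R ^ 2 * C * R) :=
    mul_le_mul_of_nonneg_left hI' (by positivity)
  have h2 : 2 * R * massFunction ρG R ≤ R ^ 2 * ((8 * Real.pi * C) * R * R) := by
    calc _ ≤ 2 * R * (4 * Real.pi * (R ^ 2 * C * R)) := by gcongr
      _ = _ := by ring
  have h3 : (8 * Real.pi * C) * R * R < 1 := by nlinarith [mul_pos (mul_pos hpi hC) hR0]
  have h4 : R ^ 2 * ((8 * Real.pi * C) * R * R) < R ^ 2 * 1 :=
    mul_lt_mul_of_pos_left h3 (by positivity)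
  unfold kerrDelta
  linarith

lemma eventually_kerrDelta_pos
    (hint : ∀ R : ℝ, 0 < R → IntervalIntegrable (fun x => x ^ 2 * ρG x) volume 0 R)
    (h : a ≠ 0 ∨ ContinuousWithinAt ρG (Ici 0) 0) :
    ∀ᶠ R in 𝓝[>] (0 : ℝ), 0 < kerrDelta a ρG R := by
  by_cases ha : a = 0
  · subst ha
    exact kerrDelta_zero_pos_of_continuousWithinAt (h.resolve_left (by simp))
  · have hid : Tendsto (fun R : ℝ => R) (𝓝[>] 0) (𝓝 0) := nhdsWithin_le_nhds
    -- Since `M → 0`, `Δ` tends to `a²`, positive when `a ≠ 0`.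
    have ht : Tendsto (kerrDelta a ρG) (𝓝[>] 0) (𝓝 (0 ^ 2 - 2 * 0 * 0 + a ^ 2)) :=
      ((hid.pow 2).sub ((hid.const_mul 2).mul (tendsto_massFunction_zero hint))).add_const _
    exact ht.eventually_const_lt (by simpa using sq_pos_of_ne_zero ha)

/-! ### Matter inside the innermost horizon -/

/-- If `Δ > 0` near the centre and there is a horizon, then the density cannot vanish wherever
`Δ > 0`: up to the innermost horizon the mass would be zero. -/
lemma exists_density_ne_zero (hcont : ContinuousOn ρG (Ioi 0))
    (hint : ∀ R : ℝ, 0 < R → IntervalIntegrable (fun x => x ^ 2 * ρG x) volume 0 R)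
    (hhorizon : ∃ R : ℝ, 0 < R ∧ kerrDelta a ρG R = 0)
    (hcentre : ∀ᶠ R in 𝓝[>] (0 : ℝ), 0 < kerrDelta a ρG R) :
    ∃ R, 0 < R ∧ 0 < kerrDelta a ρG R ∧ ρG R ≠ 0 := by
  by_contra! hvac
  obtain ⟨ε, hε : 0 < ε, hpos⟩ := mem_nhdsGT_iff_exists_Ioo_subset.1 hcentre
  obtain ⟨Rh, hRh, hΔh⟩ := hhorizon
  have hΔc : ContinuousOn (kerrDelta a ρG) (Ioi 0) := fun x hx =>
    (hasDerivAt_kerrDelta hcont hint hx).continuousAt.continuousWithinAt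
  -- Keeps the set `Δ ≤ 0` away from the centre, so that compactness yields a least element.
  have hεle : ∀ r, 0 < r → kerrDelta a ρG r ≤ 0 → ε ≤ r := fun r hr h => by
    by_contra! hlt
    exact (hpos ⟨hr, hlt⟩ : 0 < kerrDelta a ρG r).not_ge h
  -- the innermost horizon
  have hK : IsCompact (Icc ε Rh ∩ kerrDelta a ρG ⁻¹' Iic 0) :=
    isCompact_Icc.of_isClosed_subset
      ((hΔc.mono fun x hx => hε.trans_le hx.1).preimage_isClosed_of_isClosed isClosed_Icc
        isClosed_Iic) inter_subset_left
  obtain ⟨R₁, ⟨⟨hR₁ε, hR₁h⟩, hR₁⟩, hmin⟩ :=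
    hK.exists_isLeast ⟨Rh, ⟨hεle Rh hRh hΔh.le, le_rfl⟩, hΔh.le⟩
  have hR₁0 : 0 < R₁ := hε.trans_le hR₁ε
  have hinner : ∀ r ∈ Ioo 0 R₁, ρG r = 0 := fun r hr => by
    refine hvac r hr.1 ?_
    by_contra! hle
    exact (hmin ⟨⟨hεle r hr.1 hle, hr.2.le.trans hR₁h⟩, hle⟩).not_gt hr.2
  have hM : massFunction ρG R₁ = 0 := by
    have : ∫ x in (0 : ℝ)..R₁, x ^ 2 * ρG x = ∫ x in (0 : ℝ)..R₁, (0 : ℝ) := by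
      -- The endpoint is discarded: nothing is known about `ρG R₁`, as `Δ` is not positive there.
      rw [intervalIntegral.integral_of_le hR₁0.le, intervalIntegral.integral_of_le hR₁0.le,
        integral_Ioc_eq_integral_Ioo, integral_Ioc_eq_integral_Ioo]
      exact setIntegral_congr_fun measurableSet_Ioo fun x hx => by simp [hinner x hx]
    simp [massFunction, this]
  have : kerrDelta a ρG R₁ ≤ 0 := hR₁
  rw [kerrDelta, hM] at this
  nlinarith [sq_nonneg a, pow_pos hR₁0 2]

end

theorem mainTheorem2 (a : ℝ) (ρG : ℝ → ℝ)
    (hcont : ContinuousOn ρG (Ioi 0))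
    (hint : ∀ R : ℝ, 0 < R → IntervalIntegrable (fun x => x ^ 2 * ρG x) volume 0 R)
    (hhorizon : ∃ R : ℝ, 0 < R ∧ kerrDelta a ρG R = 0) :
    (∀ U : Set (ℝ × ℝ), IsOpen U → U ⊆ kerrDomain a ρG →
      (∃ q ∈ U, kerrDensity a ρG q.1 q.2 ≠ 0) →
      ¬ ∃ (D : HorizonData) (Ω pϑ : ℝ → ℝ → ℝ), IsKerrLikeSolutionOn a ρG U D Ω pϑ) ∧
    (a ≠ 0 ∨ ContinuousWithinAt ρG (Ici 0) 0 →
      ¬ ∃ (D : HorizonData) (Ω pϑ : ℝ → ℝ → ℝ),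
        IsKerrLikeSolutionOn a ρG (kerrDomain a ρG) D Ω pϑ) := by
  constructor
  · rintro U hU hUK ⟨⟨R, ϑ⟩, hq, hρ⟩ ⟨D, Ω, pϑ, hD⟩
    exact hρ (by simp [kerrDensity, hD.density_eq_zero hcont hint hU hUK hq])
  · rintro h ⟨D, Ω, pϑ, hD⟩
    obtain ⟨R, hR, hΔ, hρ⟩ :=
      exists_density_ne_zero hcont hint hhorizon (eventually_kerrDelta_pos hint h)
    obtain ⟨ϑ, hϑ⟩ := exists_mem_kerrDomain hR hΔ
    exact hρ (hD.density_eq_zero hcont hint (isOpen_kerrDomain hcont hint) subset_rfl hϑ)
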